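/- Fix an integer $B\ge 1$ and let $\eta$ be the law of $\xi^{B-1}$, where $\xi$ is uniform on $[0,1]$. For measures on $\mathbb R$ write $\nu'\preceq\nu$ if $\int\varphi\,d\nu'\le\int\varphi\,d\nu$ for every convex non-decreasing $\varphi:\mathbb R\to\mathbb R$ (for which both integrals exist). Let $I$ be a number of items, $n\ge 1$ an integer, and $\rho$ a continuously differentiable probability density on $X=[0,1]^I$ with $c_0\le\rho\le c_1$ for some constants $0<c_0<c_1$. Partition $X$ into $n^I$ closed cubes $\sigma_j$ of edge length $1/n$ with centers $\theta_j$, and put $\mu_j=n^{-I}\min_{\sigma_j}\rho$ for $1\le j\le n^I$ and $\mu_0=1-\sum_{j\ge1}\mu_j$. Let $\mathcal D_n$ be the problem of maximizing $\sum_{j}\mu_j\big(\langle\theta_j,p_j\rangle-u_j\big)$ over $u_j\in\mathbb R$, $p_j\in\mathbb R^I$ ($1\le j\le n^I$) subject to - $u_j\ge 0$, $\;0\le p_{j,k}\le 1$, $\;u_i-u_j\ge\langle\theta_i-\theta_j,p_j\rangle$ for all $i,j$ and all items $k$; - $\mu_0\,\delta_0+\sum_{j\ge1}\mu_j\,\delta_{p_{j,k}}\preceq\eta$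 for all items $k$. For a partition $0=q_0<q_1<\dots<q_M=1$ put $w_m=\eta([q_{m-1},q_m])$ and $t_m=\frac1{w_m}\int_{[q_{m-1},q_m]}t\,d\eta(t)$ (if $w_m=0$, the value of $t_m$ is irrelevant below), and let $\mathcal D_{n,M}$ be the linear program with the same objective, maximized over $u_j$, $p_j$ and additional variables $\pi_{j,m,k}$, where the last constraint is replaced by $$\sum_j\pi_{j,m,k}\le w_m,\qquad \sum_m\pi_{j,m,k}\le\mu_j,\qquad \sum_m t_m\,\pi_{j,m,k}\ge p_{j,k}\,\mu_j,\qquad \pi_{j,m,k}\ge 0$$ for all $j,m,k$. Let $\varepsilon=\max_m|q_m-q_{m-1}|$. Then there is a constant $C$ that depends only on $\eta$ (and not on $n$, $\rho$, $I$, $M$, or the partition) such that, whenever $\varepsilon\le\frac16$, the maxima of both problems are attained and $$\max\mathcal D_{n,M}\;\le\;\max\mathcal D_n\;\le\;(1+\varepsilon C)\cdot\max\mathcal D_{n,M}.$$ -/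

import Mathlib

open MeasureTheory Set
open scoped ENNReal Matrix

noncomputable section

namespace RochetChone

/-- `Majorizes ν ν'`: the measure `ν` majorizes `ν'`, i.e. `∫ φ dν ≥ ∫ φ dν'` for every convex
non-decreasing `φ` (for which both integrals exist; on compactly supported finite measures
this is every such `φ`). -/
def Majorizes (ν ν' : Measure ℝ) : Prop :=
  ∀ φ : ℝ → ℝ, ConvexOn ℝ univ φ → Monotone φ → Integrable φ ν → Integrable φ ν' →
    ∫ x, φ x ∂ν' ≤ ∫ x, φ x ∂ν

/-- The law of `ξ ^ (B - 1)` for `ξ` uniform on `[0, 1]`. -/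
def bidderLaw (B : ℕ) : Measure ℝ :=
  Measure.map (fun x : ℝ => x ^ (B - 1)) (volume.restrict (Icc (0 : ℝ) 1))

/-- `ρ` is a `C¹` probability density on the type space `[0, 1]^I`, bounded away from zero and
from infinity. -/
structure IsTypeDensity (I : ℕ) (ρ : (Fin I → ℝ) → ℝ) : Prop where
  contDiffOn : ContDiffOn ℝ 1 ρ (Icc 0 1)
  bounds : ∃ c C : ℝ, 0 < c ∧ c < C ∧ ∀ x ∈ Icc (0 : Fin I → ℝ) 1, c ≤ ρ x ∧ ρ x ≤ C
  integral_eq_one : ∫ x in Icc (0 : Fin I → ℝ) 1, ρ x = 1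

/-- The indices of the `n ^ I` cubes of edge length `1 / n` that partition `[0, 1]^I`. -/
abbrev Cell (I n : ℕ) : Type := Fin I → Fin n

/-- The closed cube with index `j`. -/
def cube {I n : ℕ} (j : Cell I n) : Set (Fin I → ℝ) :=
  Icc (fun i => ((j i : ℕ) : ℝ) / n) (fun i => (((j i : ℕ) : ℝ) + 1) / n)

/-- The center `θ_j` of the cube with index `j`. -/
def center {I n : ℕ} (j : Cell I n) : Fin I → ℝ :=
  fun i => (((j i : ℕ) : ℝ) + 1 / 2) / n

/-- The weight `μ_j = n^{-I} · min_{σ_j} ρ`. -/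
def weight {I n : ℕ} (ρ : (Fin I → ℝ) → ℝ) (j : Cell I n) : ℝ :=
  1 / (n : ℝ) ^ I * sInf (ρ '' cube j)

/-- The remaining weight `μ_0 = 1 - ∑ μ_j`. -/
def weightZero {I : ℕ} (n : ℕ) (ρ : (Fin I → ℝ) → ℝ) : ℝ :=
  1 - ∑ j : Cell I n, weight ρ j

/-- The common objective `∑ μ_j (⟨θ_j, p_j⟩ - u_j)` of both programs. -/
def objective {I n : ℕ} (ρ : (Fin I → ℝ) → ℝ) (u : Cell I n → ℝ) (p : Cell I n → Fin I → ℝ) : ℝ :=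
  ∑ j, weight ρ j * (center j ⬝ᵥ p j - u j)

/-- The constraints shared by both programs: individual rationality (ir), feasibility (fs), and
incentive compatibility (ic). -/
structure BasicConstraints {I n : ℕ} (u : Cell I n → ℝ) (p : Cell I n → Fin I → ℝ) : Prop where
  ir : ∀ j, 0 ≤ u j
  fs : ∀ j k, 0 ≤ p j k ∧ p j k ≤ 1
  ic : ∀ i j, (center i - center j) ⬝ᵥ p j ≤ u i - u j

/-- The discrete measure `μ_0 δ_0 + ∑ μ_j δ_{p_{j,k}}`. -/
def allocationLaw {I n : ℕ} (ρ : (Fin I → ℝ) → ℝ) (p : Cell I n → Fin I → ℝ) (k : Fin I) :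
    Measure ℝ :=
  ENNReal.ofReal (weightZero n ρ) • Measure.dirac 0 +
    ∑ j, ENNReal.ofReal (weight ρ j) • Measure.dirac (p j k)

/-- The values of the objective on the feasible points of the program `D_n`, whose constraints are
the basic ones and the majorization constraint (mj). -/
def valuesD {I : ℕ} (n : ℕ) (η : Measure ℝ) (ρ : (Fin I → ℝ) → ℝ) : Set ℝ :=
  {v | ∃ (u : Cell I n → ℝ) (p : Cell I n → Fin I → ℝ),
    BasicConstraints u p ∧ (∀ k, Majorizes η (allocationLaw ρ p k)) ∧ objective ρ u p = v}

/-- `0 = q_0 < q_1 < ... < q_M = 1`. -/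
structure IsPartition {M : ℕ} (q : Fin (M + 1) → ℝ) : Prop where
  strictMono : StrictMono q
  zero : q 0 = 0
  last : q (Fin.last M) = 1

/-- The mesh `max_m |q_m - q_{m-1}|`. -/
def mesh {M : ℕ} (q : Fin (M + 1) → ℝ) : ℝ :=
  ⨆ m : Fin M, |q m.succ - q m.castSucc|

/-- `w_m = η([q_{m-1}, q_m])`. -/
def binMass {M : ℕ} (η : Measure ℝ) (q : Fin (M + 1) → ℝ) (m : Fin M) : ℝ :=
  η.real (Icc (q m.castSucc) (q m.succ))

/-- `t_m`, the mean of `η` on `[q_{m-1}, q_m]`. If `w_m = 0` its value plays no role in the linear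
program, as the variables with that `m` are then zero. -/
def binMean {M : ℕ} (η : Measure ℝ) (q : Fin (M + 1) → ℝ) (m : Fin M) : ℝ :=
  1 / binMass η q m * ∫ t in Icc (q m.castSucc) (q m.succ), t ∂η

/-- The linear constraints (mj-T), (mj-J), (mj-E), (mj-P), stating that `π` encodes for every item a
discretized sub-coupling of the cell weights and `η` with the supermartingale inequality. -/
structure LinearMajorization {I n M : ℕ} (η : Measure ℝ) (ρ : (Fin I → ℝ) → ℝ)
    (q : Fin (M + 1) → ℝ) (p : Cell I n → Fin I → ℝ) (π : Cell I n → Fin M → Fin I → ℝ) :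
    Prop where
  mjT : ∀ m k, ∑ j, π j m k ≤ binMass η q m
  mjJ : ∀ j k, ∑ m, π j m k ≤ weight ρ j
  mjE : ∀ j k, p j k * weight ρ j ≤ ∑ m, binMean η q m * π j m k
  mjP : ∀ j m k, 0 ≤ π j m k

/-- The values of the objective on the feasible points of the linear program `D_{n,M}`. -/
def valuesDM {I M : ℕ} (n : ℕ) (η : Measure ℝ) (ρ : (Fin I → ℝ) → ℝ) (q : Fin (M + 1) → ℝ) :
    Set ℝ :=
  {v | ∃ (u : Cell I n → ℝ) (p : Cell I n → Fin I → ℝ) (π : Cell I n → Fin M → Fin I → ℝ),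
    BasicConstraints u p ∧ LinearMajorization η ρ q p π ∧ objective ρ u p = v}

end RochetChone

end

/-! Both inequalities compare `η` with its binned version `∑ w_m δ_{t_m}`. If `π` is feasible for
the linear program, each `p_j` is at most a barycenter of the points `t_m`, with the unassigned part
of `μ_j` placed at `0`. Jensen over `m` (`sum_mul_le_of_subcoupling`) and Jensen inside every bin
(`binMass_mul_le_setIntegral`) then yield majorization by `η`, so `D_{n,M}` is a restriction of
`D_n`. Conversely, `t_m` exceeds every point of its bin up to `ε`, so the binned law dominates `η`
shifted left by `ε`. A finite Strassen theorem (`exists_subcoupling`, by convex separation) turns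
majorization into a sub-coupling for `p_j - ε`. To absorb this additive error, mix in the product
coupling, which gives every cell the mean `b` of `η`: with weight `s = ε / b` it restores what `(1 -
s) p_j` needs. Basic constraints survive scaling of `(u, p)` by a factor in `[0, 1]` and the
objective is homogeneous, so only a factor `1 / (1 - s)` is lost. As `b = 1 / B`, the constant `2 /
b ^ 2` depends on `η` alone. The maxima exist by compactness: on the set where the objective is
nonnegative, `u` is bounded. -/

namespace RochetChone

/-! ### Finite duality and sub-couplings -/

/-- A theorem of the alternative: a compact convex set that misses the nonpositive orthant lies in
the open half space given by a nonnegative functional. -/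
theorem exists_nonneg_dotProduct_pos {ι : Type*} [Fintype ι] {K : Set (ι → ℝ)}
    (hK : IsCompact K) (hc : Convex ℝ K) (h : ∀ x ∈ K, ¬ x ≤ 0) :
    ∃ c : ι → ℝ, 0 ≤ c ∧ ∀ x ∈ K, 0 < c ⬝ᵥ x := by
  classical
  obtain ⟨f, s, t, hs, hst, ht⟩ := geometric_hahn_banach_compact_closed hc hK
    (convex_Iic (𝕜 := ℝ) (0 : ι → ℝ)) isClosed_Iic
    (Set.disjoint_left.2 fun x hx hx' => h x hx hx')
  have ht0 : t < 0 := by simpa using ht 0 (by simp)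
  have hf : ∀ x, f x = ∑ i, x i * f (Pi.single i 1) := fun x => by
    conv_lhs => rw [pi_eq_sum_univ' x]
    simp [map_sum, Pi.single]
  refine ⟨fun i => - f (Pi.single i 1), fun i => ?_, fun x hx => ?_⟩
  · show 0 ≤ - f (Pi.single i 1)
    by_contra! hi
    have hi' : 0 < f (Pi.single i 1) := by linarith
    -- As `t < 0`, this multiple of the basis vector lies in the orthant, yet `f` equals `t` there.
    have := ht ((t / f (Pi.single i 1)) • Pi.single i 1) (by
      intro j
      by_cases hj : j = i
      · subst hj
        simpa using div_nonpos_of_nonpos_of_nonneg ht0.le hi'.le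
      · simp [hj])
    rw [map_smul, smul_eq_mul, div_mul_cancel₀ _ hi'.ne'] at this
    exact lt_irrefl _ this
  · have h1 := hs x hx
    rw [hf x] at h1
    simp only [dotProduct, neg_mul, Finset.sum_neg_distrib]
    have : ∑ i, f (Pi.single i 1) * x i = ∑ i, x i * f (Pi.single i 1) :=
      Finset.sum_congr rfl fun i _ => mul_comm _ _
    linarith

/-- The pointwise maximum of finitely many affine functions with nonnegative slopes, and of zero. -/
theorem exists_convexOn_isLUB_affine {J : Type*} [Fintype J] (y β : J → ℝ) (hy : 0 ≤ y) :
    ∃ φ : ℝ → ℝ, ConvexOn ℝ univ φ ∧ Monotone φ ∧ (∀ x, 0 ≤ φ x) ∧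
      (∀ j x, y j * x - β j ≤ φ x) ∧
      ∀ x a, 0 ≤ a → (∀ j, y j * x - β j ≤ a) → φ x ≤ a := by
  let g : Option J → ℝ → ℝ := fun o => o.elim 0 fun j x => y j * x - β j
  refine ⟨Finset.univ.sup' Finset.univ_nonempty g, ?_, ?_, fun x => ?_, fun j x => ?_,
    fun x a ha hj => ?_⟩
  · refine Finset.sup'_induction (p := fun φ => ConvexOn ℝ univ φ) _ _
      (fun φ hφ ψ hψ => hφ.sup hψ) fun o _ => ?_
    cases o with
    | none => exact convexOn_const 0 convex_univ
    | some j =>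
      refine ⟨convex_univ, fun a _ b _ s t _ _ hst => le_of_eq ?_⟩
      simp only [g, Option.elim, smul_eq_mul]
      linear_combination β j * hst
  · refine Finset.sup'_induction (p := fun φ : ℝ → ℝ => Monotone φ) _ _
      (fun φ hφ ψ hψ => hφ.sup hψ) fun o _ => ?_
    cases o with
    | none => exact monotone_const
    | some j =>
      intro a b hab
      have := mul_le_mul_of_nonneg_left hab (hy j)
      simp only [g, Option.elim]
      linarith
  · have := Finset.le_sup' g (Finset.mem_univ none) x
    exact this
  · have := Finset.le_sup' g (Finset.mem_univ (some j)) x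
    exact this
  · rw [Finset.sup'_apply]
    refine Finset.sup'_le _ _ fun o _ => ?_
    cases o with
    | none => exact ha
    | some j => exact hj j

/-- A finite form of Strassen's theorem: if `∑ j, μ j • δ_{d j}` is dominated by
`∑ m, w m • δ_{t m}` for all nonnegative convex nondecreasing functions, then there is a
sub-coupling with the submartingale inequality. -/
theorem exists_subcoupling {J T : Type*} [Fintype J] [Fintype T] (μ d : J → ℝ) (w t : T → ℝ)
    (hμ : ∀ j, 0 ≤ μ j)
    (h : ∀ φ : ℝ → ℝ, ConvexOn ℝ univ φ → Monotone φ → (∀ x, 0 ≤ φ x) →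
      ∑ j, μ j * φ (d j) ≤ ∑ m, w m * φ (t m)) (hw : ∀ m, 0 ≤ w m) :
    ∃ π : J → T → ℝ, (∀ j m, 0 ≤ π j m) ∧ (∀ m, ∑ j, π j m ≤ w m) ∧ (∀ j, ∑ m, π j m ≤ μ j) ∧
      ∀ j, d j * μ j ≤ ∑ m, t m * π j m := by
  classical
  let Q : Set (J → T → ℝ) := {π | (∀ j m, 0 ≤ π j m) ∧ ∀ j, ∑ m, π j m ≤ μ j}
  have hQ : IsCompact Q := by
    have hcl : IsClosed Q := by
      simp only [Q, ofPred_and, ofPred_forall]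
      refine IsClosed.inter (isClosed_iInter fun j => isClosed_iInter fun m => ?_)
        (isClosed_iInter fun j => ?_)
      · exact isClosed_le (by fun_prop) (by fun_prop)
      · exact isClosed_le (by fun_prop) (by fun_prop)
    refine (isCompact_Icc (a := (0 : J → T → ℝ)) (b := fun j _ => μ j)).of_isClosed_subset hcl ?_
    intro π hπ
    refine ⟨fun j m => hπ.1 j m, fun j m => le_trans ?_ (hπ.2 j)⟩
    exact Finset.single_le_sum (f := π j) (fun m _ => hπ.1 j m) (Finset.mem_univ m)
  have hQc : Convex ℝ Q := by
    intro a ha b hb r s hr hs hrs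
    refine ⟨fun j m => ?_, fun j => ?_⟩
    · exact add_nonneg (mul_nonneg hr (ha.1 j m)) (mul_nonneg hs (hb.1 j m))
    · simp only [Pi.add_apply, Pi.smul_apply, smul_eq_mul, Finset.sum_add_distrib,
        ← Finset.mul_sum]
      calc _ ≤ r * μ j + s * μ j := add_le_add (mul_le_mul_of_nonneg_left (ha.2 j) hr)
              (mul_le_mul_of_nonneg_left (hb.2 j) hs)
        _ = μ j := by rw [← add_mul, hrs, one_mul]
  -- `Q` keeps the constraints that make it compact; `L π ≤ 0` encodes the others.
  let L : (J → T → ℝ) → (T ⊕ J → ℝ) := fun π =>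
    Sum.elim (fun m => ∑ j, π j m - w m) (fun j => d j * μ j - ∑ m, t m * π j m)
  have hL : Continuous L := by
    refine continuous_pi fun i => ?_
    cases i <;> simp only [L, Sum.elim_inl, Sum.elim_inr] <;> fun_prop
  have hLc : Convex ℝ (L '' Q) := by
    rintro _ ⟨a, ha, rfl⟩ _ ⟨b, hb, rfl⟩ r s hr hs hrs
    refine ⟨r • a + s • b, hQc ha hb hr hs hrs, ?_⟩
    ext i
    cases i with
    | inl m =>
      simp only [L, Sum.elim_inl, Pi.add_apply, Pi.smul_apply, smul_eq_mul,
        Finset.sum_add_distrib, ← Finset.mul_sum]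
      linear_combination w m * hrs
    | inr j =>
      simp only [L, Sum.elim_inr, Pi.add_apply, Pi.smul_apply, smul_eq_mul, mul_add,
        Finset.sum_add_distrib, mul_left_comm (t _), ← Finset.mul_sum]
      linear_combination - d j * μ j * hrs
  by_contra hne
  have hdis : ∀ x ∈ L '' Q, ¬ x ≤ 0 := by
    rintro _ ⟨π, hπ, rfl⟩ hle
    refine hne ⟨π, hπ.1, fun m => ?_, hπ.2, fun j => ?_⟩
    · have := hle (Sum.inl m)
      simp only [L, Sum.elim_inl, Pi.zero_apply] at this
      linarith
    · have := hle (Sum.inr j)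
      simp only [L, Sum.elim_inr, Pi.zero_apply] at this
      linarith
  obtain ⟨c, hc, hpos⟩ := exists_nonneg_dotProduct_pos (hQ.image hL) hLc hdis
  let α : T → ℝ := fun m => c (Sum.inl m)
  let y : J → ℝ := fun j => c (Sum.inr j)
  have hα : ∀ m, 0 ≤ α m := fun m => hc _
  have hy : 0 ≤ y := fun j => hc _
  -- Gain from sending a unit of mass from `j` to `m`; `none` leaves it unassigned, at gain `0`.
  let g : J → Option T → ℝ := fun j o => o.elim 0 fun m => y j * t m - α m
  have hmax : ∀ j, ∃ o, ∀ o', g j o' ≤ g j o := fun j => by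
    obtain ⟨o, -, ho⟩ := Finset.exists_max_image Finset.univ (g j) Finset.univ_nonempty
    exact ⟨o, fun o' => ho o' (Finset.mem_univ _)⟩
  choose o ho using hmax
  obtain ⟨φ, hφc, hφm, hφ0, hφle, hφlub⟩ :=
    exists_convexOn_isLUB_affine y (fun j => g j (o j)) hy
  have h1 : ∀ m, φ (t m) ≤ α m := fun m => hφlub _ _ (hα m) fun j => by
    have := ho j (some m)
    simp only [g, Option.elim] at this ⊢
    linarith
  -- The best response to the multipliers: all of `μ j` goes to an optimal target. Positivity of the
  -- functional at this `π` contradicts the hypothesis for `φ`.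
  let π : J → T → ℝ := fun j m => if o j = some m then μ j else 0
  have hsum : ∀ j (f : T → ℝ), ∑ m, f m * π j m = (o j).elim 0 f * μ j := fun j f => by
    simp only [π]
    cases o j with
    | none => simp
    | some m => simp
  have hπ : π ∈ Q := by
    refine ⟨fun j m => ?_, fun j => ?_⟩
    · simp only [π]
      split_ifs
      exacts [hμ j, le_rfl]
    · have := hsum j fun _ => 1
      simp only [one_mul] at this
      rw [this]
      cases o j with
      | none => simpa using hμ j
      | some m => simp
  have h2 := hpos _ ⟨π, hπ, rfl⟩
  simp only [dotProduct, Fintype.sum_sum_type, L, Sum.elim_inl, Sum.elim_inr] at h2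
  change 0 < ∑ m, α m * (∑ j, π j m - w m) + ∑ j, y j * (d j * μ j - ∑ m, t m * π j m) at h2
  have h3 : ∑ m, α m * (∑ j, π j m - w m) + ∑ j, y j * (d j * μ j - ∑ m, t m * π j m)
      = ∑ j, μ j * (y j * d j - g j (o j)) - ∑ m, w m * α m := by
    have e1 : ∑ m, α m * ∑ j, π j m = ∑ j, (o j).elim 0 α * μ j := by
      simp only [Finset.mul_sum]
      rw [Finset.sum_comm]
      exact Finset.sum_congr rfl fun j _ => hsum j α
    simp only [mul_sub, Finset.sum_sub_distrib, e1, hsum]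
    have e2 : ∀ j, (o j).elim 0 α * μ j - y j * ((o j).elim 0 t * μ j) = - (μ j * g j (o j)) := by
      intro j
      simp only [g]
      cases o j with
      | none => simp
      | some m => simp only [Option.elim]; ring
    have e3 : ∑ j, (o j).elim 0 α * μ j - ∑ j, y j * ((o j).elim 0 t * μ j)
        = - ∑ j, μ j * g j (o j) := by
      rw [← Finset.sum_sub_distrib, ← Finset.sum_neg_distrib]
      exact Finset.sum_congr rfl fun j _ => e2 j
    have e4 : ∑ j, y j * (d j * μ j) = ∑ j, μ j * (y j * d j) :=
      Finset.sum_congr rfl fun j _ => by ring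
    have e5 : ∑ m, α m * w m = ∑ m, w m * α m :=
      Finset.sum_congr rfl fun j _ => by ring
    linarith
  have h4 : ∑ j, μ j * (y j * d j - g j (o j)) ≤ ∑ j, μ j * φ (d j) :=
    Finset.sum_le_sum fun j _ => mul_le_mul_of_nonneg_left (hφle j (d j)) (hμ j)
  have h5 : ∑ m, w m * φ (t m) ≤ ∑ m, w m * α m :=
    Finset.sum_le_sum fun m _ => mul_le_mul_of_nonneg_left (h1 m) (hw m)
  have h6 := h φ hφc hφm hφ0
  linarith

/-- A sub-coupling between `μ` and `w` with the submartingale inequality gives convex domination: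
the weighted values of `φ` at the points `p j` are at most those at the points `t m`. -/
theorem sum_mul_le_of_subcoupling {J T : Type*} [Fintype J] [Fintype T] {μ p : J → ℝ}
    {w t : T → ℝ} {π : J → T → ℝ} (hμ : ∀ j, 0 < μ j) (hπ : ∀ j m, 0 ≤ π j m)
    (hw : ∀ m, ∑ j, π j m ≤ w m) (hμπ : ∀ j, ∑ m, π j m ≤ μ j)
    (hp : ∀ j, p j * μ j ≤ ∑ m, t m * π j m) (ht : ∀ m, 0 ≤ t m) {φ : ℝ → ℝ}
    (hφ : ConvexOn ℝ univ φ) (hm : Monotone φ) (h0 : φ 0 = 0) :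
    ∑ j, μ j * φ (p j) ≤ ∑ m, w m * φ (t m) := by
  have key : ∀ j, μ j * φ (p j) ≤ ∑ m, π j m * φ (t m) := by
    intro j
    -- The index `none` carries the unassigned mass, located at `0` where `φ` vanishes.
    let c : Option T → ℝ := fun o => o.elim ((μ j - ∑ m, π j m) / μ j) fun m => π j m / μ j
    let x : Option T → ℝ := fun o => o.elim 0 t
    have h1 := hφ.map_sum_le (t := Finset.univ) (w := c) (p := x) (by
      rintro (_ | m) -
      · exact div_nonneg (sub_nonneg.2 (hμπ j)) (hμ j).le
      · exact div_nonneg (hπ j m) (hμ j).le) (by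
      rw [Fintype.sum_option]
      simp only [c, Option.elim]
      rw [← Finset.sum_div, ← add_div, sub_add_cancel, div_self (hμ j).ne']) (by simp)
    simp only [Fintype.sum_option, c, x, Option.elim, smul_eq_mul, mul_zero, zero_add, h0] at h1
    have h2 : p j ≤ ∑ m, π j m / μ j * t m := by
      have : ∑ m, π j m / μ j * t m = (∑ m, t m * π j m) / μ j := by
        rw [Finset.sum_div]
        exact Finset.sum_congr rfl fun m _ => by ring
      rw [this, le_div_iff₀ (hμ j)]
      exact hp j
    have h3 := mul_le_mul_of_nonneg_left ((hm h2).trans h1) (hμ j).le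
    refine h3.trans (le_of_eq ?_)
    rw [Finset.mul_sum]
    refine Finset.sum_congr rfl fun m _ => ?_
    have := (hμ j).ne'
    field_simp
  calc ∑ j, μ j * φ (p j) ≤ ∑ j, ∑ m, π j m * φ (t m) := Finset.sum_le_sum fun j _ => key j
    _ = ∑ m, (∑ j, π j m) * φ (t m) := by
        rw [Finset.sum_comm]
        simp only [Finset.sum_mul]
    _ ≤ _ := Finset.sum_le_sum fun m _ => mul_le_mul_of_nonneg_right (hw m) (h0 ▸ hm (ht m))

/-! ### The law of `ξ ^ (B - 1)` -/

instance isProbabilityMeasure_bidderLaw (B : ℕ) : IsProbabilityMeasure (bidderLaw B) := by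
  have : IsProbabilityMeasure (volume.restrict (Icc (0 : ℝ) 1)) := ⟨by simp⟩
  exact Measure.isProbabilityMeasure_map (by fun_prop)

theorem ae_mem_Icc_bidderLaw (B : ℕ) : ∀ᵐ x ∂bidderLaw B, x ∈ Icc (0 : ℝ) 1 := by
  refine (ae_map_iff (p := fun x => x ∈ Icc (0 : ℝ) 1) (by fun_prop) measurableSet_Icc).2 ?_
  filter_upwards [ae_restrict_mem measurableSet_Icc] with x hx
  exact ⟨pow_nonneg hx.1 _, pow_le_one₀ hx.1 hx.2⟩

/-- The power map is injective on `[0, 1]` unless `B - 1 = 0`, when the law is the point mass at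
`1`; hence the restriction on `a`. -/
theorem bidderLaw_singleton (B : ℕ) {a : ℝ} (ha : a < 1) : bidderLaw B {a} = 0 := by
  rw [bidderLaw, Measure.map_apply (by fun_prop) (measurableSet_singleton a),
    Measure.restrict_apply
      ((by fun_prop : Measurable fun x : ℝ => x ^ (B - 1)) (measurableSet_singleton a))]
  refine Set.Subsingleton.measure_zero ?_ _
  rintro x ⟨hx, hx'⟩ y ⟨hy, hy'⟩
  simp only [mem_preimage, mem_singleton_iff] at hx hy
  rcases Nat.eq_zero_or_pos (B - 1) with h | h
  · rw [h, pow_zero] at hx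
    exact absurd hx ha.ne'
  · exact (pow_left_inj₀ hx'.1 hy'.1 h.ne').1 (hx.trans hy.symm)

theorem integral_id_bidderLaw {B : ℕ} (hB : 1 ≤ B) : ∫ x, x ∂bidderLaw B = 1 / B := by
  rw [bidderLaw, integral_map (by fun_prop) (by fun_prop), integral_Icc_eq_integral_Ioc,
    ← intervalIntegral.integral_of_le zero_le_one, integral_pow]
  simp [Nat.cast_sub hB]

/-! ### Discretizing `η` into bins -/

section Bins

variable {η : Measure ℝ} {M : ℕ} {q : Fin (M + 1) → ℝ}

theorem integrable_of_continuous_of_ae_mem_Icc [IsFiniteMeasure η]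
    (hs : ∀ᵐ x ∂η, x ∈ Icc (0 : ℝ) 1) {f : ℝ → ℝ} (hf : Continuous f) : Integrable f η := by
  rw [← Measure.restrict_eq_self_of_ae_mem hs]
  exact hf.continuousOn.integrableOn_compact isCompact_Icc

/-- Adjacent closed bins share only a point below `1`, which is null; a possible atom at `1` is
counted once, in the last bin. Passing to `Ioc` drops only left endpoints and so keeps that atom. -/
theorem sum_setIntegral_bins (hq : IsPartition q) (hs : ∀ᵐ x ∂η, x ∈ Icc (0 : ℝ) 1)
    (ha : ∀ a < 1, η {a} = 0) {f : ℝ → ℝ} (hf : Integrable f η) :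
    ∑ m : Fin M, ∫ x in Icc (q m.castSucc) (q m.succ), f x ∂η = ∫ x, f x ∂η := by
  have hlt : ∀ m : Fin M, q m.castSucc < q m.succ := fun m => hq.strictMono Fin.castSucc_lt_succ
  have hle1 : ∀ i, q i ≤ 1 := fun i => hq.last ▸ hq.strictMono.monotone (Fin.le_last i)
  let a : ℕ → ℝ := fun i => if h : i < M + 1 then q ⟨i, h⟩ else 0
  have h1 : ∀ m : Fin M, ∫ x in Icc (q m.castSucc) (q m.succ), f x ∂η
      = ∫ x in a m..a (m + 1), f x ∂η := fun m => by
    have e1 : a m = q m.castSucc := by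
      simp only [a, dif_pos (Nat.lt_succ_of_lt m.2)]; rfl
    have e2 : a (m + 1) = q m.succ := by
      simp only [a, dif_pos (Nat.succ_lt_succ m.2)]; rfl
    rw [e1, e2, intervalIntegral.integral_of_le (hlt m).le]
    exact (setIntegral_congr_set (Ioc_ae_eq_Icc' (ha _ ((hlt m).trans_le (hle1 _))))).symm
  have ha0 : a 0 = 0 := by simpa [a] using hq.zero
  have haM : a M = 1 := (dif_pos M.lt_succ_self).trans hq.last
  rw [Finset.sum_congr rfl fun m _ => h1 m,
    ← Finset.sum_range fun i => ∫ x in a i..a (i + 1), f x ∂η,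
    intervalIntegral.sum_integral_adjacent_intervals fun k _ => hf.intervalIntegrable, ha0, haM,
    intervalIntegral.integral_of_le zero_le_one,
    setIntegral_congr_set (Ioc_ae_eq_Icc' (ha 0 one_pos)), Measure.restrict_eq_self_of_ae_mem hs]

theorem binMass_nonneg (m : Fin M) : 0 ≤ binMass η q m := measureReal_nonneg

theorem sum_binMass [IsProbabilityMeasure η] (hq : IsPartition q)
    (hs : ∀ᵐ x ∂η, x ∈ Icc (0 : ℝ) 1) (ha : ∀ a < 1, η {a} = 0) :
    ∑ m, binMass η q m = 1 := by
  simpa [binMass] using sum_setIntegral_bins hq hs ha (integrable_const (1 : ℝ))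

theorem binMean_mul_binMass [IsFiniteMeasure η] (m : Fin M) :
    binMean η q m * binMass η q m = ∫ t in Icc (q m.castSucc) (q m.succ), t ∂η := by
  by_cases h : binMass η q m = 0
  · rw [h, mul_zero, Measure.restrict_eq_zero.2, integral_zero_measure]
    exact (measureReal_eq_zero_iff).1 h
  · rw [binMean]
    field_simp

theorem binMean_nonneg (hq : IsPartition q) (m : Fin M) : 0 ≤ binMean η q m := by
  refine mul_nonneg (div_nonneg zero_le_one (binMass_nonneg m)) ?_
  refine setIntegral_nonneg measurableSet_Icc fun x hx => le_trans ?_ hx.1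
  exact hq.zero ▸ hq.strictMono.monotone (Fin.zero_le _)

/-- Jensen's inequality for the normalized restriction of `η` to a bin. -/
theorem binMass_mul_le_setIntegral [IsFiniteMeasure η] (hs : ∀ᵐ x ∂η, x ∈ Icc (0 : ℝ) 1)
    {φ : ℝ → ℝ} (hφ : ConvexOn ℝ univ φ) (hc : Continuous φ) (m : Fin M) :
    binMass η q m * φ (binMean η q m) ≤ ∫ t in Icc (q m.castSucc) (q m.succ), φ t ∂η := by
  by_cases h : binMass η q m = 0
  · rw [h, zero_mul, Measure.restrict_eq_zero.2, integral_zero_measure]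
    exact (measureReal_eq_zero_iff).1 h
  · have h1 := hφ.map_set_average_le (μ := η) (t := Icc (q m.castSucc) (q m.succ)) (f := id)
      hc.continuousOn isClosed_univ (fun h0 => h ((measureReal_eq_zero_iff).2 h0))
      (measure_ne_top _ _) (by simp)
      (integrable_of_continuous_of_ae_mem_Icc hs continuous_id).integrableOn
      (integrable_of_continuous_of_ae_mem_Icc hs hc).integrableOn
    rw [setAverage_eq, setAverage_eq] at h1
    have h2 := mul_le_mul_of_nonneg_left h1 (binMass_nonneg (η := η) (q := q) m)
    simp only [smul_eq_mul, id] at h2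
    change _ ≤ binMass η q m * ((binMass η q m)⁻¹ * _) at h2
    rw [mul_inv_cancel_left₀ h] at h2
    rw [binMean, one_div]
    exact h2

/-- A converse to Jensen up to a shift: the bin mean is at least the left endpoint, hence at least
`t - ε` for `t` in the bin. -/
theorem setIntegral_comp_sub_le [IsFiniteMeasure η] (hs : ∀ᵐ x ∂η, x ∈ Icc (0 : ℝ) 1)
    {φ : ℝ → ℝ} (hm : Monotone φ) (hc : Continuous φ) {ε : ℝ} (m : Fin M)
    (hε : q m.succ - q m.castSucc ≤ ε) :
    ∫ t in Icc (q m.castSucc) (q m.succ), φ (t - ε) ∂η ≤ binMass η q m * φ (binMean η q m) := by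
  by_cases h : binMass η q m = 0
  · rw [h, zero_mul, Measure.restrict_eq_zero.2, integral_zero_measure]
    exact (measureReal_eq_zero_iff).1 h
  have hpos : 0 < binMass η q m := (binMass_nonneg m).lt_of_ne' h
  have hlow : q m.castSucc ≤ binMean η q m := by
    have h1 : ∫ t in Icc (q m.castSucc) (q m.succ), q m.castSucc ∂η
        ≤ ∫ t in Icc (q m.castSucc) (q m.succ), t ∂η :=
      setIntegral_mono_on (integrable_const _)
        (integrable_of_continuous_of_ae_mem_Icc hs continuous_id).integrableOn measurableSet_Icc
        fun x hx => hx.1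
    rw [setIntegral_const, smul_eq_mul, ← binMean_mul_binMass, mul_comm] at h1
    exact le_of_mul_le_mul_right h1 hpos
  calc ∫ t in Icc (q m.castSucc) (q m.succ), φ (t - ε) ∂η
      ≤ ∫ t in Icc (q m.castSucc) (q m.succ), φ (binMean η q m) ∂η :=
        setIntegral_mono_on
          (integrable_of_continuous_of_ae_mem_Icc hs (by fun_prop)).integrableOn
          (integrable_const _) measurableSet_Icc fun x hx => hm (by linarith [hx.2])
    _ = _ := by rw [setIntegral_const, smul_eq_mul]; rfl

theorem sub_le_mesh (m : Fin M) : q m.succ - q m.castSucc ≤ mesh q :=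
  (le_abs_self _).trans
    (le_ciSup (f := fun m : Fin M => |q m.succ - q m.castSucc|) (finite_range _).bddAbove m)

theorem mesh_nonneg : 0 ≤ mesh q := Real.iSup_nonneg fun _ => abs_nonneg _

end Bins

/-! ### Cell weights and the allocation law -/

section Weights

variable {I n : ℕ} {ρ : (Fin I → ℝ) → ℝ}

theorem cube_subset (hn : 0 < n) (j : Cell I n) : cube j ⊆ Icc 0 1 := by
  have hn' : (0 : ℝ) < n := Nat.cast_pos.2 hn
  refine Icc_subset_Icc (fun i => by simp only [Pi.zero_apply]; positivity) fun i => ?_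
  rw [Pi.one_apply, div_le_one hn']
  exact_mod_cast (j i).2

theorem cube_nonempty (j : Cell I n) : (cube j).Nonempty := by
  refine nonempty_Icc.2 fun i => ?_
  gcongr
  linarith

theorem weight_pos (hn : 0 < n) (hρ : IsTypeDensity I ρ) (j : Cell I n) : 0 < weight ρ j := by
  obtain ⟨c, C, hc, -, h⟩ := hρ.bounds
  have hn' : (0 : ℝ) < n := Nat.cast_pos.2 hn
  refine mul_pos (by positivity) (hc.trans_le (le_csInf ((cube_nonempty j).image _) ?_))
  rintro _ ⟨x, hx, rfl⟩
  exact (h x (cube_subset hn j hx)).1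

theorem sum_weight_le_one (hn : 0 < n) (hρ : IsTypeDensity I ρ) :
    ∑ j : Cell I n, weight ρ j ≤ 1 := by
  obtain ⟨c, C, hc, -, h⟩ := hρ.bounds
  have hn' : (0 : ℝ) < n := Nat.cast_pos.2 hn
  have hint : IntegrableOn ρ (Icc 0 1) :=
    hρ.contDiffOn.continuousOn.integrableOn_compact isCompact_Icc
  -- Half-open cubes are genuinely disjoint and have the same volume as the closed ones.
  let S : Cell I n → Set (Fin I → ℝ) := fun j =>
    Set.pi univ fun i => Ico (((j i : ℕ) : ℝ) / n) ((((j i : ℕ) : ℝ) + 1) / n)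
  have hScube : ∀ j, S j ⊆ cube j := fun j x hx =>
    ⟨fun i => (hx i (mem_univ i)).1, fun i => (hx i (mem_univ i)).2.le⟩
  have hSm : ∀ j, MeasurableSet (S j) := fun j =>
    MeasurableSet.univ_pi fun i => measurableSet_Ico
  have hSI : ∀ j, S j ⊆ Icc 0 1 := fun j => (hScube j).trans (cube_subset hn j)
  have hvol : ∀ j, volume.real (S j) = 1 / (n : ℝ) ^ I := fun j => by
    rw [measureReal_def, Real.volume_pi_Ico_toReal]
    · simp [← sub_div]
    · intro i
      simp only
      gcongr
      linarith
  have hdisj : Pairwise (Function.onFun Disjoint S) := by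
    intro j j' hjj
    obtain ⟨i, hi⟩ := Function.ne_iff.1 hjj
    refine Set.disjoint_left.2 fun x hx hx' => hi ?_
    have h1 := hx i (mem_univ i)
    have h2 := hx' i (mem_univ i)
    have h3 := h1.1.trans_lt h2.2
    have h4 := h2.1.trans_lt h1.2
    rw [div_lt_div_iff_of_pos_right hn'] at h3 h4
    have h5 : (j i : ℕ) < (j' i : ℕ) + 1 := by exact_mod_cast h3
    have h6 : (j' i : ℕ) < (j i : ℕ) + 1 := by exact_mod_cast h4
    exact Fin.ext (by omega)
  have hle : ∀ j, weight ρ j ≤ ∫ x in S j, ρ x := fun j => by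
    rw [weight, ← hvol j, ← smul_eq_mul, ← setIntegral_const]
    refine setIntegral_mono_on (integrableOn_const (ne_top_of_le_ne_top
      (isCompact_Icc (a := (0 : Fin I → ℝ)) (b := 1)).measure_ne_top (measure_mono (hSI j))))
      (hint.mono_set (hSI j)) (hSm j) fun x hx => ?_
    refine csInf_le ⟨c, ?_⟩ (mem_image_of_mem ρ (hScube j hx))
    rintro _ ⟨y, hy, rfl⟩
    exact (h y (cube_subset hn j hy)).1
  calc ∑ j : Cell I n, weight ρ j ≤ ∑ j, ∫ x in S j, ρ x := Finset.sum_le_sum fun j _ => hle j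
    _ = ∫ x in ⋃ j, S j, ρ x :=
        (integral_iUnion_fintype hSm hdisj fun j => hint.mono_set (hSI j)).symm
    _ ≤ ∫ x in Icc 0 1, ρ x := setIntegral_mono_set hint
        ((ae_restrict_mem measurableSet_Icc).mono fun x hx => hc.le.trans (h x hx).1)
        (iUnion_subset hSI).eventuallyLE
    _ = 1 := hρ.integral_eq_one

theorem weightZero_nonneg (hn : 0 < n) (hρ : IsTypeDensity I ρ) : 0 ≤ weightZero n ρ :=
  sub_nonneg.2 (sum_weight_le_one hn hρ)

theorem integrable_allocationLaw (p : Cell I n → Fin I → ℝ) (k : Fin I) (φ : ℝ → ℝ) :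
    Integrable φ (allocationLaw ρ p k) := by
  refine Integrable.add_measure ?_ ?_
  · exact (integrable_dirac (by simp)).smul_measure ENNReal.ofReal_ne_top
  · exact integrable_finsetSum_measure.2 fun j _ =>
      (integrable_dirac (by simp)).smul_measure ENNReal.ofReal_ne_top

theorem integral_allocationLaw (hn : 0 < n) (hρ : IsTypeDensity I ρ) (p : Cell I n → Fin I → ℝ)
    (k : Fin I) (φ : ℝ → ℝ) :
    ∫ x, φ x ∂allocationLaw ρ p k
      = weightZero n ρ * φ 0 + ∑ j, weight ρ j * φ (p j k) := by
  have hi : ∀ (a w : ℝ), Integrable φ (ENNReal.ofReal w • Measure.dirac a) := fun a w =>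
    (integrable_dirac (by simp)).smul_measure ENNReal.ofReal_ne_top
  rw [allocationLaw, integral_add_measure (hi _ _)
    (integrable_finsetSum_measure.2 fun j _ => hi _ _),
    integral_finsetSum_measure fun j _ => hi _ _]
  simp only [integral_smul_measure, integral_dirac, smul_eq_mul]
  rw [ENNReal.toReal_ofReal (weightZero_nonneg hn hρ)]
  congr 1
  exact Finset.sum_congr rfl fun j _ => by rw [ENNReal.toReal_ofReal (weight_pos hn hρ j).le]

end Weights

theorem _root_.ConvexOn.continuous_of_univ {φ : ℝ → ℝ} (hφ : ConvexOn ℝ univ φ) :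
    Continuous φ :=
  continuousOn_univ.1 (hφ.continuousOn isOpen_univ)

/-! ### Majorization versus the linear constraints -/

section Majorization

variable {η : Measure ℝ} [IsProbabilityMeasure η] {I n M : ℕ} {q : Fin (M + 1) → ℝ}
  {ρ : (Fin I → ℝ) → ℝ} {p : Cell I n → Fin I → ℝ}

theorem LinearMajorization.majorizes {π : Cell I n → Fin M → Fin I → ℝ}
    (h : LinearMajorization η ρ q p π) (hn : 0 < n) (hρ : IsTypeDensity I ρ) (hq : IsPartition q)
    (hs : ∀ᵐ x ∂η, x ∈ Icc (0 : ℝ) 1) (ha : ∀ a < 1, η {a} = 0) (k : Fin I) :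
    Majorizes η (allocationLaw ρ p k) := by
  intro φ hφ hm _ _
  -- After normalizing to value `0` at `0`, the atom `μ_0 δ_0` contributes nothing.
  have hψ : ConvexOn ℝ univ fun x => φ x - φ 0 := by
    simpa only [sub_eq_add_neg] using! hφ.add_const (-φ 0)
  have hψm : Monotone fun x => φ x - φ 0 := fun x y hxy => sub_le_sub_right (hm hxy) _
  have h1 := sum_mul_le_of_subcoupling (fun j => weight_pos hn hρ j) (fun j m => h.mjP j m k)
    (fun m => h.mjT m k) (fun j => h.mjJ j k) (fun j => h.mjE j k) (binMean_nonneg hq) hψ hψm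
    (sub_self _)
  have h2 : ∑ m, binMass η q m * (φ (binMean η q m) - φ 0) ≤ ∫ x, (φ x - φ 0) ∂η := by
    rw [← sum_setIntegral_bins hq hs ha
      (integrable_of_continuous_of_ae_mem_Icc hs hψ.continuous_of_univ)]
    exact Finset.sum_le_sum fun m _ =>
      binMass_mul_le_setIntegral hs hψ hψ.continuous_of_univ m
  rw [integral_sub (integrable_of_continuous_of_ae_mem_Icc hs hφ.continuous_of_univ)
    (integrable_const _), integral_const, probReal_univ, one_smul] at h2
  rw [integral_allocationLaw hn hρ, weightZero]
  simp only [mul_sub, Finset.sum_sub_distrib, ← Finset.sum_mul] at h1 h2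
  linarith

/-- Majorization is tested on `φ (· - mesh q)`, whose integral against `η` is controlled by the
binned law; nonnegativity of `φ` allows the `μ_0` term to be dropped. -/
theorem Majorizes.exists_binCoupling (hn : 0 < n) (hρ : IsTypeDensity I ρ) (hq : IsPartition q)
    (hs : ∀ᵐ x ∂η, x ∈ Icc (0 : ℝ) 1) (ha : ∀ a < 1, η {a} = 0) {k : Fin I}
    (h : Majorizes η (allocationLaw ρ p k)) :
    ∃ π : Cell I n → Fin M → ℝ, (∀ j m, 0 ≤ π j m) ∧ (∀ m, ∑ j, π j m ≤ binMass η q m) ∧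
      (∀ j, ∑ m, π j m ≤ weight ρ j) ∧
      ∀ j, (p j k - mesh q) * weight ρ j ≤ ∑ m, binMean η q m * π j m := by
  refine exists_subcoupling _ _ _ _ (fun j => (weight_pos hn hρ j).le) (fun φ hφ hm h0 => ?_)
    fun m => binMass_nonneg m
  have hψ : ConvexOn ℝ univ fun x => φ (x - mesh q) := by
    simpa [Function.comp_def, sub_eq_add_neg] using hφ.translate_left (-mesh q)
  have h1 := h _ hψ (fun x y hxy => hm (sub_le_sub_right hxy _))
    (integrable_of_continuous_of_ae_mem_Icc hs hψ.continuous_of_univ)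
    (integrable_allocationLaw _ _ _)
  rw [integral_allocationLaw hn hρ, ← sum_setIntegral_bins hq hs ha
      (integrable_of_continuous_of_ae_mem_Icc hs hψ.continuous_of_univ)] at h1
  have h2 := mul_nonneg (weightZero_nonneg hn hρ) (h0 (0 - mesh q))
  have h3 := Finset.sum_le_sum fun m (_ : m ∈ Finset.univ) =>
    setIntegral_comp_sub_le hs hm hφ.continuous_of_univ m (sub_le_mesh (q := q) m)
  linarith

/-- Mixing the coupling given by majorization with the product coupling, with weights `1 - a` and
`a`, makes up for the additive discretization error. -/
theorem exists_linearMajorization_smul (hn : 0 < n) (hρ : IsTypeDensity I ρ) (hq : IsPartition q)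
    (hs : ∀ᵐ x ∂η, x ∈ Icc (0 : ℝ) 1) (ha : ∀ a < 1, η {a} = 0)
    (h : ∀ k, Majorizes η (allocationLaw ρ p k)) {a l : ℝ} (ha0 : 0 ≤ a) (ha1 : a ≤ 1)
    (hl : ∀ j k, l * p j k ≤ (1 - a) * (p j k - mesh q) + a * ∫ x, x ∂η) :
    ∃ π, LinearMajorization η ρ q (l • p) π := by
  choose π hπ0 hπT hπJ hπE using fun k => (h k).exists_binCoupling hn hρ hq hs ha
  refine ⟨fun j m k => (1 - a) * π k j m + a * (weight ρ j * binMass η q m),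
    fun m k => ?_, fun j k => ?_, fun j k => ?_, fun j m k => ?_⟩
  · rw [Finset.sum_add_distrib, ← Finset.mul_sum, ← Finset.mul_sum, ← Finset.sum_mul]
    have h1 := mul_le_mul_of_nonneg_left (hπT k m) (sub_nonneg.2 ha1)
    have h2 := mul_le_mul_of_nonneg_left
      (mul_le_of_le_one_left (binMass_nonneg (η := η) (q := q) m) (sum_weight_le_one hn hρ)) ha0
    linarith
  · rw [Finset.sum_add_distrib, ← Finset.mul_sum, ← Finset.mul_sum, ← Finset.mul_sum,
      sum_binMass hq hs ha]
    have h1 := mul_le_mul_of_nonneg_left (hπJ k j) (sub_nonneg.2 ha1)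
    linarith
  · have hmean : ∑ m, binMean η q m * binMass η q m = ∫ x, x ∂η := by
      simp only [binMean_mul_binMass]
      exact sum_setIntegral_bins hq hs ha
        (integrable_of_continuous_of_ae_mem_Icc hs continuous_id)
    have h1 := mul_le_mul_of_nonneg_left (hπE k j) (sub_nonneg.2 ha1)
    have h2 := mul_le_mul_of_nonneg_right (hl j k) (weight_pos hn hρ j).le
    have h3 : ∑ m, binMean η q m * ((1 - a) * π k j m + a * (weight ρ j * binMass η q m))
        = (1 - a) * ∑ m, binMean η q m * π k j m
          + a * weight ρ j * ∑ m, binMean η q m * binMass η q m := by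
      rw [Finset.mul_sum, Finset.mul_sum, ← Finset.sum_add_distrib]
      exact Finset.sum_congr rfl fun m _ => by ring
    rw [h3, hmean]
    simp only [Pi.smul_apply, smul_eq_mul]
    linarith
  · exact add_nonneg (mul_nonneg (sub_nonneg.2 ha1) (hπ0 k j m))
      (mul_nonneg ha0 (mul_nonneg (weight_pos hn hρ j).le (binMass_nonneg m)))

end Majorization

/-! ### Attainment of the maxima -/

section Existence

variable {I n M : ℕ} {ρ : (Fin I → ℝ) → ℝ}

theorem center_nonneg (j : Cell I n) : 0 ≤ center j := fun i => by
  simp only [center, Pi.zero_apply]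
  positivity

theorem BasicConstraints.smul {u : Cell I n → ℝ} {p : Cell I n → Fin I → ℝ}
    (h : BasicConstraints u p) {l : ℝ} (h0 : 0 ≤ l) (h1 : l ≤ 1) :
    BasicConstraints (l • u) (l • p) where
  ir j := mul_nonneg h0 (h.ir j)
  fs j k := ⟨mul_nonneg h0 (h.fs j k).1, mul_le_one₀ h1 (h.fs j k).1 (h.fs j k).2⟩
  ic i j := by
    have := mul_le_mul_of_nonneg_left (h.ic i j) h0
    simpa only [Pi.smul_apply, dotProduct_smul, smul_eq_mul, ← mul_sub] using this

theorem objective_smul (u : Cell I n → ℝ) (p : Cell I n → Fin I → ℝ) (l : ℝ) :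
    objective ρ (l • u) (l • p) = l * objective ρ u p := by
  rw [objective, objective, Finset.mul_sum]
  refine Finset.sum_congr rfl fun j _ => ?_
  simp only [Pi.smul_apply, dotProduct_smul, smul_eq_mul]
  ring

theorem isClosed_basicConstraints :
    IsClosed {x : (Cell I n → ℝ) × (Cell I n → Fin I → ℝ) | BasicConstraints x.1 x.2} := by
  have : {x : (Cell I n → ℝ) × (Cell I n → Fin I → ℝ) | BasicConstraints x.1 x.2} =
      (⋂ j, {x | 0 ≤ x.1 j}) ∩ ((⋂ j, ⋂ k, {x | 0 ≤ x.2 j k} ∩ {x | x.2 j k ≤ 1}) ∩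
        ⋂ i, ⋂ j, {x | (center i - center j) ⬝ᵥ x.2 j ≤ x.1 i - x.1 j}) := by
    ext x
    simp only [mem_inter_iff, mem_iInter, mem_ofPred_eq]
    exact ⟨fun h => ⟨h.ir, h.fs, h.ic⟩, fun h => ⟨h.1, h.2.1, h.2.2⟩⟩
  rw [this]
  refine (isClosed_iInter fun j => ?_).inter ((isClosed_iInter fun j => isClosed_iInter fun k =>
    IsClosed.inter ?_ ?_).inter (isClosed_iInter fun i => isClosed_iInter fun j => ?_)) <;>
  · try simp only [dotProduct]
    exact isClosed_le (by fun_prop) (by fun_prop)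

theorem continuous_objective :
    Continuous fun x : (Cell I n → ℝ) × (Cell I n → Fin I → ℝ) => objective ρ x.1 x.2 := by
  simp only [objective, dotProduct]
  fun_prop

/-- The objective attains its maximum under the basic constraints and any closed constraint on the
allocation that admits the zero allocation. -/
theorem exists_isGreatest_objective (hn : 0 < n) (hρ : IsTypeDensity I ρ)
    {P : Set (Cell I n → Fin I → ℝ)} (hP : IsClosed P) (h0 : 0 ∈ P) :
    ∃ v, IsGreatest {v | ∃ u p, BasicConstraints u p ∧ p ∈ P ∧ objective ρ u p = v} v ∧ 0 ≤ v := by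
  -- The zero point has objective `0`, so negative values can be discarded; what remains forces an
  -- upper bound on `u`.
  let S : Set ((Cell I n → ℝ) × (Cell I n → Fin I → ℝ)) :=
    {x | BasicConstraints x.1 x.2} ∩ {x | x.2 ∈ P} ∩ {x | 0 ≤ objective ρ x.1 x.2}
  have hcl : IsClosed S := (isClosed_basicConstraints.inter (hP.preimage continuous_snd)).inter
    (isClosed_le continuous_const continuous_objective)
  let R : ℝ := ∑ i : Cell I n, weight ρ i * (center i ⬝ᵥ 1)
  have hsub : S ⊆ Icc 0 (fun j => R / weight ρ j) ×ˢ Icc 0 1 := by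
    rintro ⟨u, p⟩ ⟨⟨hb, -⟩, hobj⟩
    refine ⟨⟨hb.ir, fun j => ?_⟩, fun j k => (hb.fs j k).1, fun j k => (hb.fs j k).2⟩
    rw [le_div_iff₀ (weight_pos hn hρ j), mul_comm]
    have h1 : weight ρ j * u j ≤ ∑ i, weight ρ i * u i :=
      Finset.single_le_sum (f := fun i => weight ρ i * u i)
        (fun i _ => mul_nonneg (weight_pos hn hρ i).le (hb.ir i)) (Finset.mem_univ j)
    have h2 : ∑ i, weight ρ i * (center i ⬝ᵥ p i) ≤ R :=
      Finset.sum_le_sum fun i _ => mul_le_mul_of_nonneg_left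
        (dotProduct_le_dotProduct_of_nonneg_left (fun k => (hb.fs i k).2) (center_nonneg i))
        (weight_pos hn hρ i).le
    have h3 : 0 ≤ ∑ i, weight ρ i * (center i ⬝ᵥ p i) - ∑ i, weight ρ i * u i := by
      rw [← Finset.sum_sub_distrib]
      simpa only [objective, mul_sub, mem_ofPred_eq] using hobj
    linarith
  have hcomp : IsCompact S := (isCompact_Icc.prod isCompact_Icc).of_isClosed_subset hcl hsub
  have hz : (0, 0) ∈ S := by
    refine ⟨⟨⟨fun j => le_rfl, fun j k => ⟨le_rfl, zero_le_one⟩, fun i j => ?_⟩, h0⟩, ?_⟩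
    · simp
    · simp [objective]
  obtain ⟨⟨u, p⟩, ⟨⟨hb, hp⟩, hobj⟩, hmax⟩ :=
    hcomp.exists_isMaxOn ⟨_, hz⟩ continuous_objective.continuousOn
  refine ⟨objective ρ u p, ⟨⟨u, p, hb, hp, rfl⟩, ?_⟩, hobj⟩
  rintro _ ⟨u', p', hb', hp', rfl⟩
  rcases le_total 0 (objective ρ u' p') with h | h
  · exact hmax (show (u', p') ∈ S from ⟨⟨hb', hp'⟩, h⟩)
  · exact h.trans hobj

/-- For each fixed `φ` the condition is a closed one: the integral is a finite sum depending
continuously on `p`, and integrability against finitely many atoms is automatic. -/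
theorem isClosed_setOf_majorizes {η : Measure ℝ} (hn : 0 < n) (hρ : IsTypeDensity I ρ) :
    IsClosed {p : Cell I n → Fin I → ℝ | ∀ k, Majorizes η (allocationLaw ρ p k)} := by
  simp only [Majorizes, integral_allocationLaw hn hρ, ofPred_forall]
  refine isClosed_iInter fun k => isClosed_iInter fun φ => isClosed_iInter fun hφ =>
    isClosed_iInter fun _ => isClosed_iInter fun _ => ?_
  simp only [integrable_allocationLaw, forall_const]
  have := hφ.continuous_of_univ
  exact isClosed_le (by fun_prop) continuous_const

/-- A projection of a closed set need not be closed, but here the set is compact: `π` is bounded by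
the bin masses and `p` by the box, which `BasicConstraints` imposes anyway. -/
theorem isClosed_setOf_linearMajorization {η : Measure ℝ} {q : Fin (M + 1) → ℝ} :
    IsClosed {p : Cell I n → Fin I → ℝ |
      p ∈ Icc 0 1 ∧ ∃ π, LinearMajorization η ρ q p π} := by
  let S : Set ((Cell I n → Fin I → ℝ) × (Cell I n → Fin M → Fin I → ℝ)) :=
    {x | LinearMajorization η ρ q x.1 x.2}
  have hS : IsClosed S := by
    have : S = ((⋂ m, ⋂ k, {x | ∑ j, x.2 j m k ≤ binMass η q m}) ∩
        ⋂ j, ⋂ k, {x | ∑ m, x.2 j m k ≤ weight ρ j}) ∩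
        ((⋂ j, ⋂ k, {x | x.1 j k * weight ρ j ≤ ∑ m, binMean η q m * x.2 j m k}) ∩
        ⋂ j, ⋂ m, ⋂ k, {x | 0 ≤ x.2 j m k}) := by
      ext x
      simp only [mem_inter_iff, mem_iInter, mem_ofPred_eq, S]
      exact ⟨fun h => ⟨⟨h.mjT, h.mjJ⟩, h.mjE, h.mjP⟩, fun h => ⟨h.1.1, h.1.2, h.2.1, h.2.2⟩⟩
    rw [this]
    refine IsClosed.inter (IsClosed.inter ?_ ?_) (IsClosed.inter ?_ ?_) <;>
    · refine isClosed_iInter fun _ => isClosed_iInter fun _ => ?_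
      try refine isClosed_iInter fun _ => ?_
      exact isClosed_le (by fun_prop) (by fun_prop)
  have hcomp : IsCompact (S ∩ Icc 0 1 ×ˢ Icc 0 fun _ m _ => binMass η q m) :=
    (isCompact_Icc.prod isCompact_Icc).inter_left hS
  convert (hcomp.image continuous_fst).isClosed using 1
  ext p
  constructor
  · rintro ⟨hp, π, hπ⟩
    refine ⟨(p, π), ⟨hπ, hp, hπ.mjP, fun j m k => le_trans ?_ (hπ.mjT m k)⟩, rfl⟩
    exact Finset.single_le_sum (f := fun j => π j m k) (fun j _ => hπ.mjP j m k)
      (Finset.mem_univ j)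
  · rintro ⟨⟨p, π⟩, ⟨hπ, hp, -⟩, rfl⟩
    exact ⟨hp, π, hπ⟩

theorem linearMajorization_zero {η : Measure ℝ} {q : Fin (M + 1) → ℝ} (hn : 0 < n)
    (hρ : IsTypeDensity I ρ) : LinearMajorization (n := n) η ρ q 0 0 where
  mjT m k := by simpa using binMass_nonneg m
  mjJ j k := by simpa using (weight_pos hn hρ j).le
  mjE j k := by simp
  mjP j m k := le_rfl

theorem exists_isGreatest_valuesDM {η : Measure ℝ} {q : Fin (M + 1) → ℝ} (hn : 0 < n)
    (hρ : IsTypeDensity I ρ) : ∃ v, IsGreatest (valuesDM n η ρ q) v ∧ 0 ≤ v := by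
  obtain ⟨v, hv, hv0⟩ := exists_isGreatest_objective hn hρ
    (isClosed_setOf_linearMajorization (I := I) (n := n) (ρ := ρ) (η := η) (q := q))
    ⟨⟨le_rfl, zero_le_one⟩, 0, linearMajorization_zero hn hρ⟩
  refine ⟨v, ?_, hv0⟩
  convert hv using 1
  ext x
  constructor
  · rintro ⟨u, p, π, hb, hπ, h⟩
    exact ⟨u, p, hb, ⟨⟨fun j k => (hb.fs j k).1, fun j k => (hb.fs j k).2⟩, π, hπ⟩, h⟩
  · rintro ⟨u, p, hb, ⟨-, π, hπ⟩, h⟩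
    exact ⟨u, p, π, hb, hπ, h⟩

theorem exists_isGreatest_valuesD {η : Measure ℝ} [IsProbabilityMeasure η] {q : Fin (M + 1) → ℝ}
    (hn : 0 < n) (hρ : IsTypeDensity I ρ) (hq : IsPartition q)
    (hs : ∀ᵐ x ∂η, x ∈ Icc (0 : ℝ) 1) (ha : ∀ a < 1, η {a} = 0) :
    ∃ v, IsGreatest (valuesD n η ρ) v := by
  obtain ⟨v, hv, -⟩ := exists_isGreatest_objective hn hρ (isClosed_setOf_majorizes (η := η) hn hρ)
    fun k => (linearMajorization_zero (q := q) hn hρ).majorizes hn hρ hq hs ha k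
  exact ⟨v, hv⟩

end Existence

/-! ### Comparison of the two maxima -/

/-- The maximum of `D_n` exceeds that of `D_{n,M}` at most by a factor `1 + O(ε)`, the constant
depending only on the mean of `η`. -/
theorem le_one_add_mesh_mul {η : Measure ℝ} [IsProbabilityMeasure η] {I n M : ℕ}
    {ρ : (Fin I → ℝ) → ℝ} {q : Fin (M + 1) → ℝ} (hn : 0 < n) (hρ : IsTypeDensity I ρ)
    (hq : IsPartition q) (hs : ∀ᵐ x ∂η, x ∈ Icc (0 : ℝ) 1) (ha : ∀ a < 1, η {a} = 0)
    (hb : 0 < ∫ x, x ∂η) {v v' : ℝ} (hv : v ∈ valuesD n η ρ)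
    (hv' : IsGreatest (valuesDM n η ρ q) v') (h0 : 0 ≤ v') :
    v ≤ (1 + mesh q * (2 / (∫ x, x ∂η) ^ 2)) * v' := by
  obtain ⟨u, p, hbc, hmaj, rfl⟩ := hv
  set b := ∫ x, x ∂η with hbdef
  have hb1 : b ≤ 1 := by
    have := integral_mono_ae (integrable_of_continuous_of_ae_mem_Icc hs continuous_id)
      (integrable_const (1 : ℝ)) (hs.mono fun x hx => hx.2)
    simpa using this
  have hε : 0 ≤ mesh q := mesh_nonneg
  have key : ∀ a l : ℝ, 0 ≤ a → a ≤ 1 → 0 < l → l ≤ 1 →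
      (∀ j k, l * p j k ≤ (1 - a) * (p j k - mesh q) + a * b) →
      1 / l ≤ 1 + mesh q * (2 / b ^ 2) →
      objective ρ u p ≤ (1 + mesh q * (2 / b ^ 2)) * v' := by
    intro a l ha0 ha1 hl0 hl1 hl hC
    obtain ⟨π, hπ⟩ := exists_linearMajorization_smul hn hρ hq hs ha hmaj ha0 ha1 hl
    have h1 : l * objective ρ u p ≤ v' :=
      hv'.2 ⟨l • u, l • p, π, hbc.smul hl0.le hl1, hπ, objective_smul u p l⟩
    calc objective ρ u p ≤ v' / l := by rwa [le_div_iff₀ hl0, mul_comm]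
      _ = 1 / l * v' := by ring
      _ ≤ _ := mul_le_mul_of_nonneg_right hC h0
  set s := mesh q / b with hsdef
  have hs0 : 0 ≤ s := div_nonneg hε hb.le
  have hms : mesh q = s * b := (div_mul_cancel₀ _ hb.ne').symm
  have hC : mesh q * (2 / b ^ 2) = 2 * s / b := by
    rw [hms]
    field_simp
  rcases le_total s (1 / 2) with h | h
  -- Since `mesh q = s * b`, the mixed-in mean `s * b` outweighs the loss `(1 - s) * mesh q`; and `1
  -- / (1 - s) ≤ 1 + 2 * s` for `s ≤ 1 / 2`.
  · refine key s (1 - s) hs0 (by linarith) (by linarith) (by linarith) (fun j k => ?_) ?_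
    · have : 0 ≤ s * (s * b) := by positivity
      rw [hms]
      linarith
    · have h2 : 2 * s ≤ 2 * s / b := le_div_self (by linarith) hb hb1
      rw [hC, div_le_iff₀ (by linarith)]
      nlinarith
  -- On a coarse mesh the product coupling alone suffices: it supports `b • p` because `p ≤ 1`, and
  -- `1 / b ≤ 2 * s / b`.
  · refine key 1 b zero_le_one le_rfl hb hb1 (fun j k => ?_) ?_
    · have := mul_le_of_le_one_right hb.le (hbc.fs j k).2
      linarith
    · rw [hC]
      have : 1 / b ≤ 2 * s / b := by gcongr; linarith
      linarith

end RochetChone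

theorem theorem5 (B : ℕ) (hB : 1 ≤ B) :
    ∃ C : ℝ, ∀ (I n M : ℕ) (ρ : (Fin I → ℝ) → ℝ) (q : Fin (M + 1) → ℝ),
      0 < n → RochetChone.IsTypeDensity I ρ → RochetChone.IsPartition q →
      RochetChone.mesh q ≤ 1 / 6 →
      ∃ maxD maxDM : ℝ,
        IsGreatest (RochetChone.valuesD n (RochetChone.bidderLaw B) ρ) maxD ∧
        IsGreatest (RochetChone.valuesDM n (RochetChone.bidderLaw B) ρ q) maxDM ∧
        maxDM ≤ maxD ∧ maxD ≤ (1 + RochetChone.mesh q * C) * maxDM := by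
  refine ⟨2 / (∫ x, x ∂(RochetChone.bidderLaw B)) ^ 2, fun I n M ρ q hn hρ hq _ => ?_⟩
  have hs := RochetChone.ae_mem_Icc_bidderLaw B
  have ha : ∀ a < 1, RochetChone.bidderLaw B {a} = 0 := fun a =>
    RochetChone.bidderLaw_singleton B
  have hb : 0 < ∫ x, x ∂(RochetChone.bidderLaw B) := by
    rw [RochetChone.integral_id_bidderLaw hB]
    positivity
  obtain ⟨v, hv⟩ := RochetChone.exists_isGreatest_valuesD hn hρ hq hs ha
  obtain ⟨v', hv', h0⟩ := RochetChone.exists_isGreatest_valuesDM (η := RochetChone.bidderLaw B)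
    (q := q) hn hρ
  refine ⟨v, v', hv, hv', ?_, RochetChone.le_one_add_mesh_mul hn hρ hq hs ha hb hv.1 hv' h0⟩
  obtain ⟨u, p, π, hbc, hπ, rfl⟩ := hv'.1
  exact hv.2 ⟨u, p, hbc, hπ.majorizes hn hρ hq hs ha, rfl⟩
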